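/- (Khovanov's conjecture.) Let $n\ge 0$, let $E$ be a complex vector space of dimension $2n$, and let $z\colon E\to E$ be a nilpotent linear endomorphism with two Jordan blocks, each of size $n$. Let $$\mathfrak{B}_{n,n}:=\{\,0=L_0\subsetneq L_1\subsetneq\dots\subsetneq L_{2n}=E \;:\; zL_j\subset L_j \text{ for all } j\,\}$$ be the $(n,n)$ Springer variety of complete flags of linear subspaces of $E$ stabilized by $z$, with its classical topology, that is, the subspace topology from the variety of complete flags in $E$. A crossingless matching of $2n$ points is a partition $a$ of $\{1,\dots,2n\}$ into pairs such that there are no $i<j<k<l$ with $\{i,k\}\in a$ and $\{j,l\}\in a$. Let $O_a$ be the set of the smaller elements of the pairs of $a$, and for $j\in O_a$ let $s_a(j)>j$ be the element paired with $j$. Put $$S_a:=\{(l_1,\dots,l_{2n})\in(\mathbb{P}^1)^{2n} : l_j=l_{s_a(j)} \text{ for all } j\in O_a\},\qquad \widetilde S:=\bigcup_a S_a\subset(\mathbb{P}^1)^{2n},$$ where $\mathbb{P}^1$ is the complex projective line with its classical topology and the union is over all crossingless matchings $a$ of $2n$ points. Then $\mathfrak{B}_{n,n}$ and $\widetilde S$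 are homeomorphic. -/

import Mathlib

/-- The classical topology on a projective space: the quotient topology from `V ∖ {0}`. -/
instance Projectivization.instTopologicalSpaceQuotient
    (K V : Type*) [DivisionRing K] [AddCommGroup V] [Module K V] [TopologicalSpace V] :
    TopologicalSpace (Projectivization K V) :=
  inferInstanceAs (TopologicalSpace (Quotient (projectivizationSetoid K V)))

/-- The complex projective line, the space of lines in `ℂ²`. -/
abbrev ComplexProjectiveLine : Type :=
  Projectivization ℂ (Fin 2 → ℂ)

/-- The linear endomorphism `z` is nilpotent with exactly two Jordan blocks, each of size `n`:
there is a basis `b (i, k)`, with `i` the number of the block and `k` the position in it, such that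
`z` sends the first vector of each block to `0` and every other one to its predecessor. -/
def HasTwoNilpotentJordanBlocks {E : Type*} [AddCommGroup E] [Module ℂ E]
    (n : ℕ) (z : E →ₗ[ℂ] E) : Prop :=
  ∃ b : Module.Basis (Fin 2 × Fin n) ℂ E,
    ∀ (i : Fin 2) (k : Fin n),
      ((k : ℕ) = 0 → z (b (i, k)) = 0) ∧
      ∀ k' : Fin n, (k : ℕ) = (k' : ℕ) + 1 → z (b (i, k)) = b (i, k')

/-- A complete flag `0 = L₀ ⊊ L₁ ⊊ ⋯ ⊊ L_m = E` in a complex vector space `E`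
(to be used with `m` the dimension of `E`). -/
@[ext]
structure CompleteFlag (m : ℕ) (E : Type*) [AddCommGroup E] [Module ℂ E] where
  /-- The subspaces of the flag. -/
  space : Fin (m + 1) → Submodule ℂ E
  strictMono : StrictMono space
  space_zero : space 0 = ⊥
  space_last : space (Fin.last m) = ⊤

namespace CompleteFlag

variable {m : ℕ} {E : Type*} [AddCommGroup E] [Module ℂ E]

/-- The complete flag of an ordered basis `b₁, …, b_m`: its `j`-th space is the span of
`b₁, …, b_j`. -/
def ofBasis (b : Module.Basis (Fin m) ℂ E) : CompleteFlag m E where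
  space := b.flag
  strictMono := b.flag_strictMono
  space_zero := b.flag_zero
  space_last := b.flag_last

/-- The classical topology of the flag variety: the quotient topology from the space of ordered
bases of `E`, which is topologized as a subspace of `E ^ m`. -/
noncomputable instance instTopologicalSpaceOfBases [TopologicalSpace E] : TopologicalSpace (CompleteFlag m E) :=
  TopologicalSpace.coinduced ofBasis
    (TopologicalSpace.induced (fun (b : Module.Basis (Fin m) ℂ E) (i : Fin m) => b i)
      inferInstance)

end CompleteFlag

/-- The `(n, n)` Springer variety of `z`: the complete flags all of whose spaces are stable
under `z`. -/
def springerVariety {E : Type*} [AddCommGroup E] [Module ℂ E] (n : ℕ) (z : E →ₗ[ℂ] E) :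
    Set (CompleteFlag (2 * n) E) :=
  {L | ∀ j, (L.space j).map z ≤ L.space j}

/-- A crossingless matching of `2n` points: a partition of the points into pairs, given by the map
that sends each point to the other point of its pair, such that there are no `i < j < k < l`
with `i` paired with `k` and `j` paired with `l`. -/
@[ext]
structure CrossinglessMatching (n : ℕ) where
  /-- The point with which a given point is paired. -/
  partner : Fin (2 * n) → Fin (2 * n)
  partner_partner : ∀ i, partner (partner i) = i
  partner_ne : ∀ i, partner i ≠ i
  crossingless : ∀ i j k l, i < j → j < k → k < l → ¬ (partner i = k ∧ partner j = l)

namespace CrossinglessMatching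

variable {n : ℕ}

/-- The set `O_a` of left endpoints of the cups of `a`; the cup that starts at `j ∈ O_a` ends
at `s_a(j) = a.partner j`. -/
def leftEndpoints (a : CrossinglessMatching n) : Set (Fin (2 * n)) :=
  {i | i < a.partner i}

/-- The subspace `S_a` of `(ℙ¹)^{2n}`. -/
def subspace (a : CrossinglessMatching n) : Set (Fin (2 * n) → ComplexProjectiveLine) :=
  {l | ∀ j ∈ a.leftEndpoints, l j = l (a.partner j)}

end CrossinglessMatching

/-- The subspace `S̃` of `(ℙ¹)^{2n}`: the union of the `S_a` over all crossingless matchings. -/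
def khovanovSpace (n : ℕ) : Set (Fin (2 * n) → ComplexProjectiveLine) :=
  ⋃ a : CrossinglessMatching n, a.subspace

/-! Write `t` for the shift on Λ = ℂ²[[t]]. A Jordan basis identifies E with Λ/tⁿΛ, and z with
multiplication by t. Taking preimages in Λ and reversing the order, a z-stable complete flag becomes
a chain of t-stable subspaces Λ = Λ₀ ⊃ Λ₁ ⊃ ⋯ ⊃ Λ₂ₙ = tⁿΛ with one-dimensional steps.

For a line l in ℂ², with orthogonal projections P, put g(l) = P_{l^⊥} + t P_l (`factor`). The
t-stable subspaces of codimension one in Λ that contain a power of t are exactly the g(l)Λ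
(`exists_eq_range_factor`). Iterating, each chain is Λ_j = g(l₁)⋯g(l_j)Λ for a unique sequence of
lines (`exists_eq_lattice`, `eq_of_lattice_eq`). It remains to find the sequences with Λ₂ₙ = tⁿΛ.

Since g(l)g(l^⊥) = t is central, neighbouring orthogonal lines cancel to a factor t. If no
neighbours are orthogonal, the product is nonzero at t = 0, so its range is not inside tΛ. Hence the
final lattice is tⁿΛ exactly when the sequence can be emptied by deleting neighbouring orthogonal
pairs. Replacing every second line by its complement turns "orthogonal" into "equal" for neighbours,
and this survives deletion of two neighbours. The resulting condition is the recursion for S̃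
(`mem_khovanovSpace_succ`), because a nonempty crossingless matching pairs two consecutive points.

This gives a bijection from S̃ to the Springer variety. It is continuous because lifts of the lines
to vectors yield a continuous adapted basis (`continuous_flagOfLines`). As S̃ is compact and the
flag variety is Hausdorff, it is a homeomorphism. -/

open Matrix

/-! ### Orthogonal projections in ℂ². -/

/-- The orthogonal projection of `ℂ²` onto the line spanned by `u`. -/
noncomputable def vectorProj (u : Fin 2 → ℂ) : (Fin 2 → ℂ) →ₗ[ℂ] (Fin 2 → ℂ) where
  toFun v := ((star u ⬝ᵥ v) / (star u ⬝ᵥ u)) • u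
  map_add' v w := by simp only [dotProduct_add, add_div, add_smul]
  map_smul' c v := by
    simp only [dotProduct_smul, smul_eq_mul, mul_div_assoc, mul_smul, RingHom.id_apply]

theorem vectorProj_apply (u v : Fin 2 → ℂ) :
    vectorProj u v = ((star u ⬝ᵥ v) / (star u ⬝ᵥ u)) • u := rfl

open scoped ComplexOrder in
theorem star_dotProduct_self_ne_zero {u : Fin 2 → ℂ} (hu : u ≠ 0) : star u ⬝ᵥ u ≠ 0 :=
  fun h => hu (dotProduct_star_self_eq_zero.1 h)

theorem vectorProj_smul {c : ℂ} (hc : c ≠ 0) (u : Fin 2 → ℂ) :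
    vectorProj (c • u) = vectorProj u := by
  rcases eq_or_ne u 0 with rfl | hu
  · simp
  refine LinearMap.ext fun v => ?_
  have := star_dotProduct_self_ne_zero hu
  have hc' : star c ≠ 0 := star_ne_zero.2 hc
  simp only [vectorProj_apply, star_smul, smul_dotProduct, dotProduct_smul, smul_smul, smul_eq_mul]
  congr 1
  field_simp

/-- A vector orthogonal to `u`, depending continuously on `u`. -/
noncomputable def vectorPerp (u : Fin 2 → ℂ) : Fin 2 → ℂ := ![-star (u 1), star (u 0)]

theorem vectorPerp_ne_zero {u : Fin 2 → ℂ} (hu : u ≠ 0) : vectorPerp u ≠ 0 := by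
  contrapose! hu
  have h0 := congrFun hu 0
  have h1 := congrFun hu 1
  ext i
  fin_cases i <;> simp_all [vectorPerp]

theorem vectorPerp_smul (c : ℂ) (u : Fin 2 → ℂ) : vectorPerp (c • u) = star c • vectorPerp u := by
  ext i
  fin_cases i <;> simp [vectorPerp]

theorem vectorPerp_vectorPerp (u : Fin 2 → ℂ) : vectorPerp (vectorPerp u) = (-1 : ℂ) • u := by
  ext i
  fin_cases i <;> simp [vectorPerp]

theorem continuous_vectorPerp : Continuous vectorPerp := by
  refine continuous_pi fun i => ?_
  fin_cases i <;> simp only [vectorPerp] <;> simp <;> fun_prop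

/-- `u` and `vectorPerp u` form an orthogonal basis of ℂ² with vectors of equal length, so the two
projections share a denominator and sum to the identity. -/
theorem vectorProj_vectorPerp {u : Fin 2 → ℂ} (hu : u ≠ 0) (v : Fin 2 → ℂ) :
    vectorProj (vectorPerp u) v = v - vectorProj u v := by
  have h := star_dotProduct_self_ne_zero hu
  have hperp : star (vectorPerp u) ⬝ᵥ vectorPerp u = star u ⬝ᵥ u := by
    simp [dotProduct, Fin.sum_univ_two, vectorPerp]
    ring
  rw [vectorProj_apply, vectorProj_apply, hperp]
  have hsum : star u ⬝ᵥ u = star (u 0) * u 0 + star (u 1) * u 1 := by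
    simp [dotProduct, Fin.sum_univ_two]
  generalize star u ⬝ᵥ u = D at h hsum
  ext i
  fin_cases i <;>
    simp [dotProduct, Fin.sum_univ_two, vectorPerp] <;>
    field_simp <;> rw [hsum] <;> simp <;> ring

/-! ### Topology of the projective line and orthogonal complements of lines. -/

namespace Projectivization

section Topology

variable {K V : Type*} [DivisionRing K] [AddCommGroup V] [Module K V] [TopologicalSpace V]

/-- The saturation of an open set is the union of its multiples by units. Openness matters because
open quotient maps, unlike general ones, are stable under products and restriction to preimages. -/
theorem isOpenQuotientMap_mk' [ContinuousConstSMul K V] :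
    IsOpenQuotientMap (mk' K : {v : V // v ≠ 0} → Projectivization K V) where
  surjective := Quotient.mk_surjective
  continuous := continuous_quotient_mk'
  isOpenMap := by
    intro U hU
    refine isOpen_coinduced.2 ?_
    have : (mk' K : {v : V // v ≠ 0} → Projectivization K V) ⁻¹' (mk' K '' U) =
        ⋃ c : Kˣ, (fun v : {v : V // v ≠ 0} =>
          (⟨c • (v : V), (smul_ne_zero_iff_ne c).2 v.2⟩ : {v : V // v ≠ 0})) ⁻¹' U := by
      ext v
      simp only [Set.mem_preimage, Set.mem_image, Set.mem_iUnion]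
      constructor
      · rintro ⟨w, hw, h⟩
        rw [mk'_eq_mk, mk'_eq_mk, mk_eq_mk_iff] at h
        obtain ⟨c, hc⟩ := h
        exact ⟨c, by simpa only [hc] using hw⟩
      · rintro ⟨c, hc⟩
        refine ⟨_, hc, ?_⟩
        rw [mk'_eq_mk, mk'_eq_mk, mk_eq_mk_iff]
        exact ⟨c, rfl⟩
    exact this ▸ isOpen_iUnion fun c => hU.preimage (by fun_prop)

end Topology

/-- The orthogonal projection of `ℂ²` onto a line. -/
noncomputable def lineProj (l : ComplexProjectiveLine) : (Fin 2 → ℂ) →ₗ[ℂ] (Fin 2 → ℂ) :=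
  vectorProj l.rep

theorem lineProj_mk (u : Fin 2 → ℂ) (hu : u ≠ 0) : lineProj (mk ℂ u hu) = vectorProj u := by
  obtain ⟨c, hc⟩ := exists_smul_eq_mk_rep ℂ u hu
  rw [lineProj, ← hc]
  exact vectorProj_smul c.ne_zero u

/-- The orthogonal complement of a line in `ℂ²`. -/
noncomputable def perp (l : ComplexProjectiveLine) : ComplexProjectiveLine :=
  mk ℂ (vectorPerp l.rep) (vectorPerp_ne_zero l.rep_nonzero)

theorem perp_mk (u : Fin 2 → ℂ) (hu : u ≠ 0) :
    perp (mk ℂ u hu) = mk ℂ (vectorPerp u) (vectorPerp_ne_zero hu) := by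
  obtain ⟨c, hc⟩ := exists_smul_eq_mk_rep ℂ u hu
  refine (mk_eq_mk_iff' _ _ _ _ _).2 ⟨star (c : ℂ), ?_⟩
  rw [← hc, ← vectorPerp_smul]
  rfl

@[simp]
theorem perp_perp (l : ComplexProjectiveLine) : perp (perp l) = l := by
  induction l using Projectivization.ind with
  | h u hu =>
    rw [perp_mk, perp_mk, mk_eq_mk_iff']
    exact ⟨-1, (vectorPerp_vectorPerp u).symm⟩

theorem perp_injective : Function.Injective perp :=
  (show Function.Involutive perp from perp_perp).injective

theorem continuous_perp : Continuous perp := by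
  rw [isOpenQuotientMap_mk'.isQuotientMap.continuous_iff]
  have : perp ∘ mk' ℂ = mk' ℂ ∘ fun u : {v : Fin 2 → ℂ // v ≠ 0} =>
      (⟨vectorPerp u, vectorPerp_ne_zero u.2⟩ : {v : Fin 2 → ℂ // v ≠ 0}) := by
    ext1 u
    exact perp_mk u.1 u.2
  rw [this]
  exact isOpenQuotientMap_mk'.continuous.comp
    ((continuous_vectorPerp.comp continuous_subtype_val).subtype_mk _)

theorem lineProj_perp (l : ComplexProjectiveLine) (v : Fin 2 → ℂ) :
    lineProj (perp l) v = v - lineProj l v := by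
  rw [perp, lineProj_mk]
  exact vectorProj_vectorPerp l.rep_nonzero v

theorem lineProj_apply (l : ComplexProjectiveLine) (v : Fin 2 → ℂ) :
    lineProj l v = ((star l.rep ⬝ᵥ v) / (star l.rep ⬝ᵥ l.rep)) • l.rep := rfl

@[simp]
theorem lineProj_rep (l : ComplexProjectiveLine) : lineProj l l.rep = l.rep := by
  rw [lineProj_apply, div_self (star_dotProduct_self_ne_zero l.rep_nonzero), one_smul]

@[simp]
theorem lineProj_lineProj (l : ComplexProjectiveLine) (v : Fin 2 → ℂ) :
    lineProj l (lineProj l v) = lineProj l v := by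
  rw [lineProj_apply l v, map_smul, lineProj_rep]

theorem lineProj_perp_eq_zero_iff {l : ComplexProjectiveLine} {v : Fin 2 → ℂ} :
    lineProj (perp l) v = 0 ↔ v ∈ l.submodule := by
  rw [lineProj_perp, sub_eq_zero, submodule_eq, Submodule.mem_span_singleton]
  constructor
  · exact fun h => ⟨_, h.symm⟩
  · rintro ⟨c, rfl⟩
    rw [map_smul, lineProj_rep]

theorem lineProj_eq_zero_iff {l : ComplexProjectiveLine} {v : Fin 2 → ℂ} :
    lineProj l v = 0 ↔ v ∈ (perp l).submodule := by
  rw [← lineProj_perp_eq_zero_iff, perp_perp]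

theorem eq_perp_of_lineProj_rep_eq_zero {l l' : ComplexProjectiveLine}
    (h : lineProj l l'.rep = 0) : l' = perp l := by
  rw [lineProj_eq_zero_iff, submodule_eq, Submodule.mem_span_singleton] at h
  rw [← mk_rep l', ← mk_rep (perp l), mk_eq_mk_iff']
  exact h

theorem continuous_lineProj_mk' {X : Type*} [TopologicalSpace X]
    {u : X → {v : Fin 2 → ℂ // v ≠ 0}} {v : X → Fin 2 → ℂ} (hu : Continuous u)
    (hv : Continuous v) : Continuous fun x => lineProj (mk' ℂ (u x)) (v x) := by
  have hu' : Continuous fun x => (u x : Fin 2 → ℂ) := continuous_subtype_val.comp hu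
  simp only [mk'_eq_mk, lineProj_mk, vectorProj_apply]
  have h1 : Continuous fun x => star (u x : Fin 2 → ℂ) ⬝ᵥ v x := hu'.star.dotProduct hv
  have h2 : Continuous fun x => star (u x : Fin 2 → ℂ) ⬝ᵥ (u x : Fin 2 → ℂ) :=
    hu'.star.dotProduct hu'
  exact (h1.div h2 fun x => star_dotProduct_self_ne_zero (u x).2).smul hu'

instance : T2Space ComplexProjectiveLine := by
  refine T2Space.of_injective_continuous (f := fun l (v : Fin 2 → ℂ) => lineProj l v)
    (fun l l' h => ?_) (continuous_pi fun v => ?_)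
  · have h1 := congrFun h (l'.rep)
    have : lineProj (perp l) l'.rep = 0 := by
      rw [lineProj_perp, sub_eq_zero]
      exact ((lineProj_rep l').symm.trans h1.symm)
    simpa using (eq_perp_of_lineProj_rep_eq_zero this).symm
  · rw [isOpenQuotientMap_mk'.isQuotientMap.continuous_iff]
    exact continuous_lineProj_mk' continuous_id continuous_const

instance : CompactSpace ComplexProjectiveLine := by
  have hS : CompactSpace (Metric.sphere (0 : Fin 2 → ℂ) 1) := inferInstance
  let f : Metric.sphere (0 : Fin 2 → ℂ) 1 → ComplexProjectiveLine := fun v =>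
    mk' ℂ ⟨v, ne_zero_of_mem_unit_sphere v⟩
  have hf : Continuous f :=
    isOpenQuotientMap_mk'.continuous.comp (continuous_subtype_val.subtype_mk _)
  refine Function.Surjective.compactSpace (f := f) hf (fun l => ?_)
  have h0 : ‖l.rep‖ ≠ 0 := norm_ne_zero_iff.2 l.rep_nonzero
  refine ⟨⟨((‖l.rep‖⁻¹ : ℝ) : ℂ) • l.rep, ?_⟩, ?_⟩
  · simp [norm_smul, h0]
  · simp only [f, mk'_eq_mk]
    conv_rhs => rw [← mk_rep l]
    rw [mk_eq_mk_iff']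
    exact ⟨_, rfl⟩

end Projectivization

/-! ### Elementary factors acting on ℂ²[[t]]. -/

open Projectivization

/-- Sequences of vectors of `ℂ²`, regarded as formal power series with coefficients in `ℂ²`. -/
abbrev PlaneSeries : Type := ℕ → Fin 2 → ℂ

namespace PlaneSeries

/-- Multiplication of a power series by the variable. -/
def shift : Module.End ℂ PlaneSeries where
  toFun m := fun k => Nat.casesOn k 0 m
  map_add' m m' := by ext k; cases k <;> simp
  map_smul' c m := by ext k; cases k <;> simp

@[simp]
theorem shift_apply_zero (m : PlaneSeries) : shift m 0 = 0 := rfl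

@[simp]
theorem shift_apply_succ (m : PlaneSeries) (k : ℕ) : shift m (k + 1) = m k := rfl

theorem shift_injective : Function.Injective shift := fun _ _ h =>
  funext fun k => congrFun h (k + 1)

theorem mem_range_shift_pow {n : ℕ} {m : PlaneSeries} :
    m ∈ LinearMap.range (shift ^ n) ↔ ∀ k < n, m k = 0 := by
  induction n generalizing m with
  | zero => simp
  | succ n ih =>
    constructor
    · rintro ⟨x, rfl⟩ k hk
      rw [pow_succ', Module.End.mul_apply]
      cases k with
      | zero => rfl
      | succ k => exact ih.1 ⟨x, rfl⟩ k (by omega)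
    · intro h
      obtain ⟨x, hx⟩ := (ih (m := fun k => m (k + 1))).2 fun k hk => h (k + 1) (by omega)
      refine ⟨x, ?_⟩
      rw [pow_succ', Module.End.mul_apply, hx]
      ext1 k
      cases k with
      | zero => exact (h 0 (by omega)).symm
      | succ k => rfl

/-- The elementary factor of a line `l`: it multiplies by the variable along `l` and is the
identity along the orthogonal complement of `l`. -/
noncomputable def factor (l : ComplexProjectiveLine) : Module.End ℂ PlaneSeries :=
  (lineProj (perp l)).compLeft ℕ + (lineProj l).compLeft ℕ * shift

theorem factor_apply (l : ComplexProjectiveLine) (m : PlaneSeries) (k : ℕ) :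
    factor l m k = lineProj (perp l) (m k) + lineProj l (shift m k) := rfl

theorem factor_mul_shift (l : ComplexProjectiveLine) : factor l * shift = shift * factor l := by
  refine LinearMap.ext fun m => funext fun k => ?_
  cases k <;> simp [factor_apply]

/-- Each of the two factors multiplies one of the summands `l`, `perp l` by the variable and fixes
the other. -/
theorem factor_mul_factor_perp (l : ComplexProjectiveLine) :
    factor l * factor (perp l) = shift := by
  refine LinearMap.ext fun m => funext fun k => ?_
  cases k <;> simp [factor_apply, lineProj_perp]

theorem factor_injective (l : ComplexProjectiveLine) : Function.Injective (factor l) := by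
  have h := factor_mul_factor_perp (perp l)
  rw [perp_perp] at h
  refine Function.Injective.of_comp (f := factor (perp l)) ?_
  rw [← Module.End.coe_mul, h]
  exact shift_injective

/-- Only the constant coefficient is constrained: its component along `l` has to vanish. -/
theorem mem_range_factor {l : ComplexProjectiveLine} {m : PlaneSeries} :
    m ∈ LinearMap.range (factor l) ↔ lineProj l (m 0) = 0 := by
  constructor
  · rintro ⟨x, rfl⟩
    simp [factor_apply, lineProj_perp]
  · intro h
    -- The preimage keeps the component along `perp l` and divides the component along `l` by the
    -- variable.
    refine ⟨fun k => lineProj (perp l) (m k) + lineProj l (m (k + 1)), funext fun k => ?_⟩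
    cases k <;> simp [factor_apply, lineProj_perp, h]

/-- The product of the elementary factors of a list of lines. -/
noncomputable def factorProd (ls : List ComplexProjectiveLine) : Module.End ℂ PlaneSeries :=
  (ls.map factor).prod

@[simp]
theorem factorProd_nil : factorProd [] = 1 := rfl

theorem factorProd_cons (l : ComplexProjectiveLine) (ls : List ComplexProjectiveLine) :
    factorProd (l :: ls) = factor l * factorProd ls := by
  simp [factorProd]

theorem factorProd_append (ls ls' : List ComplexProjectiveLine) :
    factorProd (ls ++ ls') = factorProd ls * factorProd ls' := by
  simp [factorProd]

theorem factorProd_mul_shift (ls : List ComplexProjectiveLine) :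
    factorProd ls * shift = shift * factorProd ls := by
  induction ls with
  | nil => rfl
  | cons l ls ih => rw [factorProd_cons, mul_assoc, ih, ← mul_assoc, factor_mul_shift, mul_assoc]

theorem factorProd_injective (ls : List ComplexProjectiveLine) :
    Function.Injective (factorProd ls) := by
  induction ls with
  | nil => exact Function.injective_id
  | cons l ls ih =>
    rw [factorProd_cons, Module.End.coe_mul]
    exact (factor_injective l).comp ih

/-- The orthogonal pair multiplies to the shift, which commutes with every factor and so moves to
the front. -/
theorem factorProd_cancel (xs ys : List ComplexProjectiveLine) (l : ComplexProjectiveLine) :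
    factorProd (xs ++ l :: perp l :: ys) = shift * factorProd (xs ++ ys) := by
  rw [factorProd_append, factorProd_append, factorProd_cons, factorProd_cons,
    ← mul_assoc (factor l), factor_mul_factor_perp, ← mul_assoc, factorProd_mul_shift, mul_assoc]

/-- If no two consecutive lines are orthogonal, the product of their elementary factors
does not vanish at the origin. -/
theorem exists_factorProd_apply_zero_ne_zero (l : ComplexProjectiveLine)
    (ls : List ComplexProjectiveLine) (h : (l :: ls).IsChain fun a b => b ≠ perp a) :
    ∃ m, ∃ c : ℂ, c ≠ 0 ∧ factorProd (l :: ls) m 0 = c • (perp l).rep := by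
  induction ls generalizing l with
  | nil =>
    refine ⟨fun _ => (perp l).rep, 1, one_ne_zero, ?_⟩
    simp [factorProd_cons, factor_apply]
  | cons l' ls ih =>
    obtain ⟨hl, h⟩ := List.isChain_cons_cons.1 h
    obtain ⟨m, c, hc, hm⟩ := ih l' h
    rw [factorProd_cons]
    -- At the origin the shifted term drops out, so the new factor acts as the projection onto `perp
    -- l`. It kills `perp l'` only if `l' = perp l`.
    simp only [Module.End.mul_apply, factor_apply, shift_apply_zero, map_zero, add_zero]
    refine ⟨m, ?_⟩
    rw [hm, map_smul, lineProj_apply, smul_smul]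
    refine ⟨_, fun h0 => ?_, rfl⟩
    have h1 : lineProj (perp l) (perp l').rep = 0 := by
      rw [lineProj_apply, (mul_eq_zero.1 h0).resolve_left hc, zero_smul]
    have h2 := eq_perp_of_lineProj_rep_eq_zero h1
    exact hl (perp_injective (by rw [h2]))

theorem not_isChain_of_range_le_range_shift {l : ComplexProjectiveLine} {ls : List ComplexProjectiveLine}
    (h : LinearMap.range (factorProd (l :: ls)) ≤ LinearMap.range shift) :
    ¬ (l :: ls).IsChain fun a b => b ≠ perp a := by
  intro hc
  obtain ⟨m, c, hc, hm⟩ := exists_factorProd_apply_zero_ne_zero l ls hc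
  obtain ⟨x, hx⟩ := h ⟨m, rfl⟩
  rw [← hx, shift_apply_zero] at hm
  exact smul_ne_zero hc (perp l).rep_nonzero hm.symm

end PlaneSeries

/-! ### Removing and inserting a pair of consecutive points in a matching. -/

namespace CrossinglessMatching

variable {n : ℕ}

theorem mem_subspace_iff {a : CrossinglessMatching n} {l : Fin (2 * n) → ComplexProjectiveLine} :
    l ∈ a.subspace ↔ ∀ j, l (a.partner j) = l j := by
  refine ⟨fun h j => ?_, fun h j _ => (h j).symm⟩
  rcases lt_or_gt_of_ne (a.partner_ne j) with hj | hj
  · have := h (a.partner j) (by simpa [leftEndpoints, a.partner_partner] using hj)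
    rwa [a.partner_partner] at this
  · exact (h j hj).symm

/-- The order embedding of points that skips the two points `i` and `i + 1`. -/
def skip (n i : ℕ) (k : Fin (2 * n)) : Fin (2 * (n + 1)) :=
  ⟨if (k : ℕ) < i then k else k + 2, by split <;> omega⟩

theorem skip_val (i : ℕ) (k : Fin (2 * n)) :
    (skip n i k : ℕ) = if (k : ℕ) < i then (k : ℕ) else k + 2 := rfl

theorem skip_lt_skip {i : ℕ} {k k' : Fin (2 * n)} : skip n i k < skip n i k' ↔ k < k' := by
  simp only [Fin.lt_def, skip_val]
  split <;> split <;> omega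

theorem skip_injective (i : ℕ) : Function.Injective (skip n i) := by
  intro k k' h
  have := congrArg Fin.val h
  simp only [skip_val] at this
  ext
  split at this <;> split at this <;> omega

theorem skip_val_ne (i : ℕ) (k : Fin (2 * n)) :
    (skip n i k : ℕ) ≠ i ∧ (skip n i k : ℕ) ≠ i + 1 := by
  simp only [skip_val]
  split <;> omega

theorem exists_skip_eq {i : ℕ} (hi : i + 1 < 2 * (n + 1)) {j : Fin (2 * (n + 1))}
    (h : (j : ℕ) ≠ i) (h' : (j : ℕ) ≠ i + 1) : ∃ k, skip n i k = j := by
  by_cases hj : (j : ℕ) < i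
  · refine ⟨⟨j, by omega⟩, Fin.ext ?_⟩
    simp [skip_val, hj]
  · refine ⟨⟨j - 2, by omega⟩, Fin.ext ?_⟩
    simp only [skip_val]
    split <;> omega

/-- A nonempty crossingless matching pairs some two consecutive points. -/
theorem exists_partner_succ (a : CrossinglessMatching (n + 1)) :
    ∃ j, (a.partner j : ℕ) = j + 1 := by
  -- `d` counts the points strictly between the ends of a pair. A pair with minimal `d` is chosen;
  -- if `d > 0`, the partner of `j + 1` either makes a crossing or gives a smaller count.
  let s : Set ℕ := {d | ∃ j : Fin (2 * (n + 1)), (a.partner j : ℕ) = j + 1 + d}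
  have hs : s.Nonempty := by
    let j : Fin (2 * (n + 1)) := ⟨0, by omega⟩
    refine ⟨a.partner j - (j + 1), j, ?_⟩
    have : (a.partner j : ℕ) ≠ 0 := fun h => a.partner_ne j (Fin.ext h)
    simp only [j] at this ⊢
    omega
  obtain ⟨j, hj⟩ := Nat.sInf_mem hs
  rcases Nat.eq_zero_or_pos (sInf s) with h0 | hpos
  · exact ⟨j, by omega⟩
  exfalso
  let j' : Fin (2 * (n + 1)) := ⟨j + 1, by omega⟩
  have hj' : (j' : ℕ) = j + 1 := rfl
  have h1 : a.partner j' ≠ j' := a.partner_ne j'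
  have h2 : a.partner j' ≠ j := fun h => by
    have := congrArg Fin.val (a.partner_partner j')
    rw [h] at this
    omega
  have h3 : a.partner j' ≠ a.partner j := fun h => by
    have := congrArg Fin.val (congrArg a.partner h)
    rw [a.partner_partner, a.partner_partner] at this
    omega
  have h1' := Fin.val_ne_of_ne h1
  have h2' := Fin.val_ne_of_ne h2
  have h3' := Fin.val_ne_of_ne h3
  have hjj' : j < j' := Fin.lt_def.2 (by omega)
  have hj'p : j' < a.partner j := Fin.lt_def.2 (by omega)
  rcases lt_or_ge (a.partner j' : ℕ) j with h | h
  · exact a.crossingless (a.partner j') j j' (a.partner j) h hjj' hj'p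
      ⟨a.partner_partner j', rfl⟩
  rcases lt_or_ge (a.partner j : ℕ) (a.partner j') with h4 | h4
  · exact a.crossingless j j' (a.partner j) (a.partner j') hjj' hj'p h4 ⟨rfl, rfl⟩
  have : sInf s ≤ (a.partner j' : ℕ) - (j' + 1) := Nat.sInf_le ⟨j', by omega⟩
  omega

/-- Removing a pair of consecutive points from a crossingless matching. -/
theorem exists_remove (a : CrossinglessMatching (n + 1)) {j : Fin (2 * (n + 1))}
    (hj : (a.partner j : ℕ) = j + 1) :
    ∃ a' : CrossinglessMatching n, ∀ k, skip n j (a'.partner k) = a.partner (skip n j k) := by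
  have hlt : (j : ℕ) + 1 < 2 * (n + 1) := hj ▸ (a.partner j).2
  have key (k : Fin (2 * n)) : ∃ k', skip n j k' = a.partner (skip n j k) := by
    obtain ⟨h1, h2⟩ := skip_val_ne j k
    refine exists_skip_eq hlt (fun h => h2 ?_) (fun h => h1 ?_)
    · rw [← hj, ← show a.partner (skip n j k) = j from Fin.ext h, a.partner_partner,
        show a.partner (skip n j k) = j from Fin.ext h]
    · rw [← hj] at h
      rw [← a.partner_partner (skip n j k), Fin.ext h, a.partner_partner]
  choose p hp using key
  refine ⟨⟨p, fun k => skip_injective j ?_, fun k hk => ?_, ?_⟩, hp⟩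
  · rw [hp, hp, a.partner_partner]
  · exact a.partner_ne (skip n j k) (by rw [← hp, hk])
  · rintro i₁ i₂ i₃ i₄ h1 h2 h3 ⟨rfl, rfl⟩
    exact a.crossingless _ _ _ _ (skip_lt_skip.2 h1) (skip_lt_skip.2 h2) (skip_lt_skip.2 h3)
      ⟨(hp _).symm, (hp _).symm⟩

/-- Inserting a pair of consecutive points into a crossingless matching. -/
theorem exists_insert (a : CrossinglessMatching n) {i : ℕ} (hi : i + 1 < 2 * (n + 1)) :
    ∃ a' : CrossinglessMatching (n + 1),
      a'.partner ⟨i, by omega⟩ = ⟨i + 1, hi⟩ ∧ a'.partner ⟨i + 1, hi⟩ = ⟨i, by omega⟩ ∧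
        ∀ k, a'.partner (skip n i k) = skip n i (a.partner k) := by
  have key (j : Fin (2 * (n + 1))) : ∃ j' : Fin (2 * (n + 1)),
      ((j : ℕ) = i → (j' : ℕ) = i + 1) ∧ ((j : ℕ) = i + 1 → (j' : ℕ) = i) ∧
        ∀ k, j = skip n i k → j' = skip n i (a.partner k) := by
    by_cases h1 : (j : ℕ) = i
    · refine ⟨⟨i + 1, hi⟩, fun _ => rfl, fun h => by omega, ?_⟩
      rintro k rfl
      exact absurd h1 (skip_val_ne i k).1
    by_cases h2 : (j : ℕ) = i + 1
    · refine ⟨⟨i, by omega⟩, fun h => by omega, fun h => rfl, ?_⟩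
      rintro k rfl
      exact absurd h2 (skip_val_ne i k).2
    obtain ⟨k, rfl⟩ := exists_skip_eq hi h1 h2
    refine ⟨skip n i (a.partner k), fun h => absurd h h1, fun h => absurd h h2, fun k' hk => ?_⟩
    rw [skip_injective i hk]
  choose p hp1 hp2 hp using key
  have hcases (j : Fin (2 * (n + 1))) :
      j = ⟨i, by omega⟩ ∨ j = ⟨i + 1, hi⟩ ∨ ∃ k, j = skip n i k := by
    by_cases h1 : (j : ℕ) = i
    · exact Or.inl (Fin.ext h1)
    by_cases h2 : (j : ℕ) = i + 1
    · exact Or.inr (Or.inl (Fin.ext h2))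
    obtain ⟨k, hk⟩ := exists_skip_eq hi h1 h2
    exact Or.inr (Or.inr ⟨k, hk.symm⟩)
  have e1 : p ⟨i, by omega⟩ = ⟨i + 1, hi⟩ := Fin.ext (hp1 _ rfl)
  have e2 : p ⟨i + 1, hi⟩ = ⟨i, by omega⟩ := Fin.ext (hp2 _ rfl)
  have e3 (k) : p (skip n i k) = skip n i (a.partner k) := hp _ k rfl
  refine ⟨⟨p, fun j => ?_, fun j => ?_, ?_⟩, e1, e2, e3⟩
  · rcases hcases j with rfl | rfl | ⟨k, rfl⟩
    · rw [e1, e2]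
    · rw [e2, e1]
    · rw [e3, e3, a.partner_partner]
  · rcases hcases j with rfl | rfl | ⟨k, rfl⟩
    · rw [e1]; simp
    · rw [e2]; simp
    · rw [e3]
      exact (skip_injective i).ne (a.partner_ne k)
  -- A crossing that involves the new pair would need a point strictly between `i` and `i + 1`.
  · rintro j₁ j₂ j₃ j₄ h1 h2 h3 ⟨rfl, rfl⟩
    rcases hcases j₁ with rfl | rfl | ⟨k₁, rfl⟩
    · rw [e1] at h2
      simp only [Fin.lt_def] at h1 h2
      omega
    · rw [e2] at h2
      simp only [Fin.lt_def] at h1 h2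
      omega
    rcases hcases j₂ with rfl | rfl | ⟨k₂, rfl⟩
    · rw [e3] at h2 h3
      rw [e1] at h3
      have := skip_val_ne i (a.partner k₁)
      simp only [Fin.lt_def] at h1 h2 h3
      omega
    · rw [e3] at h2 h3
      rw [e2] at h3
      simp only [Fin.lt_def] at h1 h2 h3
      omega
    rw [e3] at h2 h3
    rw [e3] at h3
    exact a.crossingless _ _ _ _ (skip_lt_skip.1 h1) (skip_lt_skip.1 h2) (skip_lt_skip.1 h3)
      ⟨rfl, rfl⟩

end CrossinglessMatching

/-! ### The recursion for S̃ and the alternation of complements. -/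

open CrossinglessMatching

/-- The recursive description of the space `S̃`. -/
theorem mem_khovanovSpace_succ {n : ℕ} {l : Fin (2 * (n + 1)) → ComplexProjectiveLine} :
    l ∈ khovanovSpace (n + 1) ↔ ∃ (i : ℕ) (hi : i + 1 < 2 * (n + 1)),
      l ⟨i + 1, hi⟩ = l ⟨i, by omega⟩ ∧ l ∘ skip n i ∈ khovanovSpace n := by
  simp only [khovanovSpace, Set.mem_iUnion, mem_subspace_iff]
  constructor
  · rintro ⟨a, ha⟩
    obtain ⟨j, hj⟩ := a.exists_partner_succ
    obtain ⟨a', ha'⟩ := a.exists_remove hj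
    refine ⟨j, hj ▸ (a.partner j).2, ?_, a', fun k => ?_⟩
    · rw [← show a.partner j = ⟨j + 1, hj ▸ (a.partner j).2⟩ from Fin.ext hj, ha]
    · rw [Function.comp_apply, ha', ha, Function.comp_apply]
  · rintro ⟨i, hi, h, a, ha⟩
    obtain ⟨a', h1, h2, h3⟩ := a.exists_insert hi
    refine ⟨a', fun j => ?_⟩
    by_cases hj : (j : ℕ) = i
    · rw [show j = ⟨i, by omega⟩ from Fin.ext hj, h1, h]
    by_cases hj' : (j : ℕ) = i + 1
    · rw [show j = ⟨i + 1, hi⟩ from Fin.ext hj', h2, h]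
    obtain ⟨k, rfl⟩ := exists_skip_eq hi hj hj'
    rw [h3]
    exact ha k

theorem isCompact_khovanovSpace (n : ℕ) : IsCompact (khovanovSpace n) := by
  have : Finite (CrossinglessMatching n) :=
    Finite.of_injective (fun a => a.partner) fun _ _ h => CrossinglessMatching.ext h
  refine (isClosed_iUnion_of_finite fun a => ?_).isCompact
  have : a.subspace = ⋂ j, {l | l (a.partner j) = l j} := by
    ext l
    simp [mem_subspace_iff]
  rw [this]
  exact isClosed_iInter fun j => isClosed_eq (continuous_apply _) (continuous_apply _)

/-- Replacing every second line by its orthogonal complement. -/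
noncomputable def alternate {m : ℕ} (l : Fin m → ComplexProjectiveLine) :
    Fin m → ComplexProjectiveLine :=
  fun j => if Even (j : ℕ) then l j else perp (l j)

theorem alternate_alternate {m : ℕ} (l : Fin m → ComplexProjectiveLine) :
    alternate (alternate l) = l := by
  ext1 j
  by_cases h : Even (j : ℕ) <;> simp [alternate, h]

theorem continuous_alternate {m : ℕ} :
    Continuous (alternate : (Fin m → ComplexProjectiveLine) → _) := by
  refine continuous_pi fun j => ?_
  by_cases h : Even (j : ℕ) <;> simp only [alternate, h, if_true, if_false]
  · exact continuous_apply j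
  · exact continuous_perp.comp (continuous_apply j)

/-- Deleting two neighbours preserves the parity of every remaining position. -/
theorem alternate_comp_skip {n : ℕ} (l : Fin (2 * (n + 1)) → ComplexProjectiveLine) (i : ℕ) :
    alternate (l ∘ skip n i) = alternate l ∘ skip n i := by
  ext1 k
  have : Even (skip n i k : ℕ) ↔ Even (k : ℕ) := by
    rw [skip_val]
    split <;> simp [Nat.even_add]
  simp only [alternate, Function.comp_apply, this]

theorem alternate_succ_eq_perp_iff {m i : ℕ} (hi : i + 1 < m)
    (l : Fin m → ComplexProjectiveLine) :
    alternate l ⟨i + 1, hi⟩ = perp (alternate l ⟨i, by omega⟩) ↔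
      l ⟨i + 1, hi⟩ = l ⟨i, by omega⟩ := by
  by_cases h : Even i
  · simp [alternate, h, Nat.even_add_one, perp_injective.eq_iff]
  · simp [alternate, h, Nat.even_add_one]

/-! ### Sequences of lines whose product of factors is a power of the shift. -/

namespace PlaneSeries

theorem factorProd_ofFn_of_eq_perp {n i : ℕ} (hi : i + 1 < 2 * (n + 1))
    {l : Fin (2 * (n + 1)) → ComplexProjectiveLine}
    (h : l ⟨i + 1, hi⟩ = perp (l ⟨i, by omega⟩)) :
    factorProd (List.ofFn l) = shift * factorProd (List.ofFn (l ∘ skip n i)) := by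
  have h1 : List.ofFn (l ∘ skip n i) =
      (List.ofFn l).take i ++ (List.ofFn l).drop (i + 2) := by
    apply List.ext_getElem
    · simp; omega
    · intro k h1 h2
      simp only [List.getElem_ofFn, List.getElem_append, Function.comp_apply, List.length_take,
        List.length_ofFn, List.getElem_take, List.getElem_drop]
      split <;> congr 1 <;> ext <;> simp only [skip_val] <;> split <;> omega
  have h2 : List.ofFn l = (List.ofFn l).take i ++
      l ⟨i, by omega⟩ :: perp (l ⟨i, by omega⟩) :: (List.ofFn l).drop (i + 2) := by
    conv_lhs => rw [← List.take_append_drop i (List.ofFn l)]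
    rw [List.drop_eq_getElem_cons (by simp; omega), List.drop_eq_getElem_cons (by simp; omega)]
    simp only [List.getElem_ofFn, h]
  rw [h1, ← factorProd_cancel, ← h2]

theorem factorProd_alternate_of_mem_khovanovSpace {n : ℕ}
    {l : Fin (2 * n) → ComplexProjectiveLine} (hl : l ∈ khovanovSpace n) :
    factorProd (List.ofFn (alternate l)) = shift ^ n := by
  induction n with
  | zero => simp
  | succ n ih =>
    obtain ⟨i, hi, h, h'⟩ := mem_khovanovSpace_succ.1 hl
    rw [factorProd_ofFn_of_eq_perp hi ((alternate_succ_eq_perp_iff hi l).2 h),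
      ← alternate_comp_skip, ih h', pow_succ']

/-- Inclusion in the range of the shift forces two neighbouring orthogonal lines. Cancelling them
and one power of the injective shift leaves the same hypothesis for `n`. -/
theorem mem_khovanovSpace_of_range_le {n : ℕ} {l : Fin (2 * n) → ComplexProjectiveLine}
    (hl : LinearMap.range (factorProd (List.ofFn (alternate l))) ≤ LinearMap.range (shift ^ n)) :
    l ∈ khovanovSpace n := by
  induction n with
  | zero =>
    refine Set.mem_iUnion.2 ⟨⟨id, fun _ => rfl, fun i => i.elim0, fun i => i.elim0⟩, ?_⟩
    exact fun i => i.elim0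
  | succ n ih =>
    have hlist : List.ofFn (alternate l) = alternate l ⟨0, by omega⟩ ::
        List.ofFn (fun i : Fin (2 * n + 1) => alternate l i.succ) := List.ofFn_succ
    have hchain := not_isChain_of_range_le_range_shift (hlist ▸ hl.trans (by
      rw [pow_succ']
      exact LinearMap.range_comp_le_range _ _))
    rw [← hlist, List.isChain_iff_getElem] at hchain
    push Not at hchain
    obtain ⟨i, hi, h⟩ := hchain
    simp only [List.length_ofFn, List.getElem_ofFn] at hi h
    refine mem_khovanovSpace_succ.2
      ⟨i, hi, (alternate_succ_eq_perp_iff hi l).1 h, ih ?_⟩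
    rw [factorProd_ofFn_of_eq_perp hi h, ← alternate_comp_skip, pow_succ'] at hl
    rintro _ ⟨x, rfl⟩
    obtain ⟨y, hy⟩ := hl ⟨x, rfl⟩
    exact ⟨y, shift_injective hy⟩

end PlaneSeries

/-! ### One Gram–Schmidt step for orthogonal projections. -/

section StarProjection

variable {F : Type*} [NormedAddCommGroup F] [InnerProductSpace ℂ F]

open scoped InnerProductSpace in
/-- The orthogonal projection onto the sum of a subspace and a line. -/
theorem Submodule.starProjection_span_singleton_sup (K K' : Submodule ℂ F)
    [K.HasOrthogonalProjection] [K'.HasOrthogonalProjection] (v x : F)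
    (h : K' = Submodule.span ℂ {v} ⊔ K) (hv : v ∉ K) :
    K'.starProjection x = K.starProjection x +
      (⟪v - K.starProjection v, x⟫_ℂ / ⟪v - K.starProjection v, v - K.starProjection v⟫_ℂ) •
        (v - K.starProjection v) := by
  set r := v - K.starProjection v with hr
  have hvr : v = r + K.starProjection v := by simp [hr]
  have hr0 : r ≠ 0 := fun h0 => hv (by rw [hvr, h0, zero_add]; exact K.starProjection_apply_mem v)
  have hrK : r ∈ Kᗮ := K.sub_starProjection_mem_orthogonal v
  have hrK' : r ∈ K' := by
    rw [h]
    exact sub_mem (Submodule.mem_sup_left (Submodule.mem_span_singleton_self v))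
      (Submodule.mem_sup_right (K.starProjection_apply_mem v))
  have hKK' : K ≤ K' := h ▸ le_sup_right
  refine Submodule.eq_starProjection_of_mem_orthogonal
    (add_mem (hKK' (K.starProjection_apply_mem x)) (K'.smul_mem _ hrK')) ?_
  have hx : x - K.starProjection x ∈ Kᗮ := K.sub_starProjection_mem_orthogonal x
  have h1 : x - (K.starProjection x + (⟪r, x⟫_ℂ / ⟪r, r⟫_ℂ) • r) ∈ Kᗮ := by
    rw [← sub_sub]
    exact sub_mem hx (Submodule.smul_mem _ _ hrK)
  have h2 : ⟪r, x - (K.starProjection x + (⟪r, x⟫_ℂ / ⟪r, r⟫_ℂ) • r)⟫_ℂ = 0 := by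
    rw [inner_sub_right, inner_add_right, inner_smul_right,
      Submodule.inner_left_of_mem_orthogonal (K.starProjection_apply_mem x) hrK,
      div_mul_cancel₀ _ (inner_self_ne_zero.2 hr0)]
    simp
  rw [h, ← Submodule.inf_orthogonal, Submodule.mem_inf]
  refine ⟨?_, h1⟩
  rw [Submodule.mem_orthogonal_singleton_iff_inner_right, hvr, inner_add_left, h2,
    Submodule.inner_right_of_mem_orthogonal (K.starProjection_apply_mem v) h1, add_zero]

end StarProjection

/-! ### The flag variety: Hausdorff property and adapted bases. -/

namespace CompleteFlag

variable {m : ℕ} {E : Type*} [AddCommGroup E] [Module ℂ E]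

section Topology

variable {F : Type*} [NormedAddCommGroup F] [InnerProductSpace ℂ F] [FiniteDimensional ℂ F]
  [TopologicalSpace E]

/-- This is Gram–Schmidt by induction: the next projection adds a rank-one term along the residual
of the next basis vector, which never vanishes. The argument `y` varies with `x` so that the
induction hypothesis also applies to that moving basis vector. -/
theorem continuous_starProjection_basis_flag (φ : E ≃ₗ[ℂ] F) (hφ : Continuous φ)
    {X : Type*} [TopologicalSpace X] {b : X → Module.Basis (Fin m) ℂ E}
    (hb : ∀ i, Continuous fun x => b x i) (j : Fin (m + 1)) {y : X → F} (hy : Continuous y) :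
    Continuous fun x => (((b x).flag j).map φ.toLinearMap).starProjection (y x) := by
  induction j using Fin.induction generalizing y with
  | zero => simpa using continuous_const
  | succ j ih =>
    have hv : Continuous fun x => φ (b x j) := hφ.comp (hb j)
    have hr : Continuous fun x => φ (b x j) -
        (((b x).flag j.castSucc).map φ.toLinearMap).starProjection (φ (b x j)) := hv.sub (ih hv)
    have hne (x : X) : φ (b x j) ∉ ((b x).flag j.castSucc).map φ.toLinearMap := by
      rintro ⟨w, hw, hw'⟩
      obtain rfl := φ.injective hw'
      simp at hw
    have key (x : X) := Submodule.starProjection_span_singleton_sup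
      (((b x).flag j.castSucc).map φ.toLinearMap) (((b x).flag j.succ).map φ.toLinearMap)
      (φ (b x j)) (y x) (by
        rw [Module.Basis.flag_succ, Submodule.map_sup, Submodule.map_span, Set.image_singleton]
        rfl) (hne x)
    simp only [key]
    refine (ih hy).add (((hr.inner hy).div (hr.inner hr) fun x => ?_).smul hr)
    rw [inner_self_ne_zero, sub_ne_zero]
    intro h
    exact hne x (h ▸ Submodule.starProjection_apply_mem _ _)

theorem continuous_starProjection_space (φ : E ≃ₗ[ℂ] F) (hφ : Continuous φ) (j : Fin (m + 1))
    (y : F) : Continuous fun L : CompleteFlag m E =>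
      ((L.space j).map φ.toLinearMap).starProjection y := by
  let _ : TopologicalSpace (Module.Basis (Fin m) ℂ E) :=
    TopologicalSpace.induced (fun (b : Module.Basis (Fin m) ℂ E) (i : Fin m) => b i) inferInstance
  refine continuous_coinduced_dom.2 ?_
  exact continuous_starProjection_basis_flag (b := id) φ hφ
    (fun i => (continuous_apply i).comp continuous_induced_dom) j continuous_const

/-- The orthogonal projections onto the spaces of a flag determine it and depend continuously on it.
The inner product is borrowed from a Euclidean space through a linear isomorphism. -/
instance [IsTopologicalAddGroup E] [ContinuousSMul ℂ E] [T2Space E] [FiniteDimensional ℂ E] :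
    T2Space (CompleteFlag m E) := by
  let φ : E ≃ₗ[ℂ] EuclideanSpace ℂ (Fin (Module.finrank ℂ E)) :=
    LinearEquiv.ofFinrankEq _ _ (by simp)
  have hφ : Continuous φ := LinearMap.continuous_of_finiteDimensional φ.toLinearMap
  refine T2Space.of_injective_continuous
    (f := fun (L : CompleteFlag m E) (p : Fin (m + 1) × _) =>
      ((L.space p.1).map φ.toLinearMap).starProjection p.2) (fun L L' h => ?_)
    (continuous_pi fun p => continuous_starProjection_space φ hφ p.1 p.2)
  ext1
  ext1 j
  refine Submodule.map_injective_of_injective φ.injective ?_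
  refine Submodule.ext fun y => ?_
  rw [← Submodule.starProjection_eq_self_iff, ← Submodule.starProjection_eq_self_iff]
  exact Eq.congr_left (congrFun h (j, y))

end Topology

/-- The dimensions give a strictly increasing self-map of `Fin (m + 1)`, which must be the identity.
-/
theorem finrank_space (L : CompleteFlag m E) (hm : Module.finrank ℂ E = m)
    [FiniteDimensional ℂ E] (j : Fin (m + 1)) : Module.finrank ℂ (L.space j) = j := by
  have hmono : StrictMono fun j => Module.finrank ℂ (L.space j) :=
    fun i j hij => Submodule.finrank_lt_finrank_of_lt (L.strictMono hij)
  have hlt (j : Fin (m + 1)) : Module.finrank ℂ (L.space j) < m + 1 :=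
    Nat.lt_succ_of_le ((Submodule.finrank_le _).trans_eq hm)
  have hmono' : StrictMono fun j => (⟨Module.finrank ℂ (L.space j), hlt j⟩ : Fin (m + 1)) :=
    fun i j hij => hmono hij
  exact le_antisymm (hmono'.apply_le (x := j)) (hmono'.le_apply (x := j))

theorem space_covBy (L : CompleteFlag m E) (hm : Module.finrank ℂ E = m)
    [FiniteDimensional ℂ E] (i : Fin m) : L.space i.castSucc ⋖ L.space i.succ := by
  refine ⟨L.strictMono Fin.castSucc_lt_succ, fun K h1 h2 => ?_⟩
  have h1 := Submodule.finrank_lt_finrank_of_lt h1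
  have h2 := Submodule.finrank_lt_finrank_of_lt h2
  rw [L.finrank_space hm] at h1 h2
  simp only [Fin.val_castSucc, Fin.val_succ] at h1 h2
  omega

/-- A basis adapted to a complete flag, from vectors in the successive differences. -/
theorem exists_ofBasis_eq (L : CompleteFlag m E) (hm : Module.finrank ℂ E = m)
    [FiniteDimensional ℂ E] (v : Fin m → E) (hv : ∀ i, v i ∈ L.space i.succ)
    (hv' : ∀ i, v i ∉ L.space i.castSucc) :
    ∃ b : Module.Basis (Fin m) ℂ E, (∀ i, b i = v i) ∧ ofBasis b = L := by
  have hspan (j : Fin (m + 1)) :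
      Submodule.span ℂ (v '' {i | i.castSucc < j}) = L.space j := by
    induction j using Fin.induction with
    | zero => simp [L.space_zero]
    | succ j ih =>
      have hset : {i : Fin m | i.castSucc < j.succ} = insert j {i | i.castSucc < j.castSucc} := by
        ext i
        simp only [Set.mem_ofPred_eq, Set.mem_insert_iff, Fin.lt_def, Fin.ext_iff, Fin.val_castSucc,
          Fin.val_succ]
        omega
      rw [hset, Set.image_insert_eq, Submodule.span_insert, ih]
      -- The span lies between two consecutive spaces of the flag, and it is not the smaller one
      -- because it contains `v j`.
      refine ((L.space_covBy hm j).eq_or_eq le_sup_right (sup_le ?_ ?_)).resolve_left fun h => ?_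
      · simpa using hv j
      · exact (L.space_covBy hm j).le
      · exact hv' j (h ▸ Submodule.mem_sup_left (Submodule.mem_span_singleton_self _))
  have htop : ⊤ ≤ Submodule.span ℂ (Set.range v) := by
    rw [← L.space_last, ← hspan]
    exact Submodule.span_mono (Set.image_subset_range _ _)
  let b := basisOfTopLeSpanOfCardEqFinrank v htop (by simp [hm])
  have hb : ⇑b = v := coe_basisOfTopLeSpanOfCardEqFinrank v htop (by simp [hm])
  refine ⟨b, fun i => congrFun hb i, CompleteFlag.ext (funext fun j => ?_)⟩
  rw [← hspan j, ← hb]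
  rfl

end CompleteFlag

/-! ### Chains of lattices and sequences of lines. -/

namespace PlaneSeries

/-- The descending chain of lattices attached to a sequence of lines. -/
noncomputable def lattice {m : ℕ} (l : Fin m → ComplexProjectiveLine) (j : ℕ) :
    Submodule ℂ PlaneSeries :=
  LinearMap.range (factorProd ((List.ofFn l).take j))

section Lattice

variable {m : ℕ} {l : Fin m → ComplexProjectiveLine}

@[simp]
theorem lattice_zero : lattice l 0 = ⊤ := by
  simp [lattice, Module.End.one_eq_id]

theorem factorProd_take_succ (i : Fin m) : factorProd ((List.ofFn l).take (i + 1)) =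
    factorProd ((List.ofFn l).take i) * factor (l i) := by
  rw [List.take_add_one, factorProd_append]
  simp [factorProd_cons]

theorem factorProd_take_mem_lattice_succ {i : Fin m} {x : PlaneSeries} :
    factorProd ((List.ofFn l).take i) x ∈ lattice l (i + 1) ↔ lineProj (l i) (x 0) = 0 := by
  rw [← mem_range_factor, lattice, factorProd_take_succ]
  constructor
  · rintro ⟨y, hy⟩
    exact ⟨y, factorProd_injective _ hy⟩
  · rintro ⟨y, rfl⟩
    exact ⟨y, rfl⟩

theorem lattice_antitone : Antitone (lattice l) := by
  refine antitone_nat_of_succ_le fun j => ?_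
  by_cases hj : j < m
  · rw [lattice, factorProd_take_succ ⟨j, hj⟩]
    exact LinearMap.range_comp_le_range _ _
  · rw [lattice, lattice, List.take_of_length_le (by simp; omega),
      List.take_of_length_le (by simp; omega)]

theorem shift_mem_lattice {j : ℕ} {x : PlaneSeries} (hx : x ∈ lattice l j) :
    shift x ∈ lattice l j := by
  obtain ⟨y, rfl⟩ := hx
  exact ⟨shift y, LinearMap.congr_fun (factorProd_mul_shift _) y⟩

theorem lattice_succ_lt (i : Fin m) : lattice l (i + 1) < lattice l i := by
  refine lt_of_le_not_ge (lattice_antitone (Nat.le_succ _)) fun h => ?_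
  have := factorProd_take_mem_lattice_succ.1
    (h ⟨fun _ => (l i).rep, rfl⟩ : factorProd ((List.ofFn l).take i) _ ∈ lattice l (i + 1))
  rw [lineProj_rep] at this
  exact (l i).rep_nonzero this

/-- The lines are recovered one at a time. Once the first `j` agree, the constant series `v` that
their product sends into the next lattice are those with `v` in the complement of the next line. -/
theorem eq_of_lattice_eq {l' : Fin m → ComplexProjectiveLine}
    (h : ∀ j ≤ m, lattice l j = lattice l' j) : l = l' := by
  have key (j : ℕ) (hj : j ≤ m) : (List.ofFn l).take j = (List.ofFn l').take j := by
    induction j with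
    | zero => simp
    | succ j ih =>
      have ih := ih (by omega)
      rw [List.take_add_one, List.take_add_one, ih]
      suffices l ⟨j, hj⟩ = l' ⟨j, hj⟩ by
        simp [show j < m from hj, this]
      refine perp_injective (submodule_injective (Submodule.ext fun v => ?_))
      rw [← lineProj_eq_zero_iff, ← lineProj_eq_zero_iff]
      have h1 := factorProd_take_mem_lattice_succ (l := l) (i := ⟨j, hj⟩) (x := fun _ => v)
      have h2 := factorProd_take_mem_lattice_succ (l := l') (i := ⟨j, hj⟩) (x := fun _ => v)
      rw [← h1, ← h2, ← h _ hj]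
      simp only [ih]
  have := key m le_rfl
  rw [List.take_of_length_le (by simp), List.take_of_length_le (by simp)] at this
  exact List.ofFn_injective this

/-- A subspace of codimension one that is stable under the shift and contains a power of it
is the range of an elementary factor. -/
theorem exists_eq_range_factor {n : ℕ} {N : Submodule ℂ PlaneSeries}
    (hshift : ∀ x ∈ N, shift x ∈ N) (hn : LinearMap.range (shift ^ n) ≤ N)
    (hne : ∃ y, y ∉ N) (hcodim : ∀ y, y ∉ N → ∀ x, ∃ c : ℂ, x - c • y ∈ N) :
    ∃ l, N = LinearMap.range (factor l) := by
  have hrange : LinearMap.range shift ≤ N := by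
    obtain ⟨y, hy⟩ := hne
    -- The last iterate of `y` outside `N` spans a complement of `N`, and the shift sends both it
    -- and `N` into `N`. So the shift acts as zero on the quotient.
    have hex : ∃ k, (shift ^ k) y ∈ N := ⟨n, hn ⟨y, rfl⟩⟩
    classical
    obtain ⟨k, hk⟩ : ∃ k, Nat.find hex = k + 1 := by
      refine Nat.exists_eq_succ_of_ne_zero fun h0 => hy ?_
      simpa [h0] using Nat.find_spec hex
    have h1 : (shift ^ k) y ∉ N := Nat.find_min hex (by omega)
    have h2 : shift ((shift ^ k) y) ∈ N := by
      have := Nat.find_spec hex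
      rwa [hk, pow_succ', Module.End.mul_apply] at this
    rintro _ ⟨x, rfl⟩
    obtain ⟨c, hc⟩ := hcodim _ h1 x
    have := N.add_mem (hshift _ hc) (N.smul_mem c h2)
    simpa using this
  let ι : (Fin 2 → ℂ) →ₗ[ℂ] PlaneSeries := LinearMap.single ℂ (fun _ => Fin 2 → ℂ) 0
  have hι (v : Fin 2 → ℂ) : ι v 0 = v := by simp [ι]
  -- `N` contains every series without constant term, so membership depends only on the constant
  -- coefficient.
  have hmem (x : PlaneSeries) : x ∈ N ↔ x 0 ∈ N.comap ι := by
    have : x - ι (x 0) ∈ N := hrange (by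
      rw [← pow_one shift, mem_range_shift_pow]
      intro k hk
      obtain rfl : k = 0 := by omega
      simp [hι])
    exact ⟨fun h => by simpa using N.sub_mem h this, fun h => by simpa using N.add_mem h this⟩
  have hfin : Module.finrank ℂ (N.comap ι) = 1 := by
    have hlt : Module.finrank ℂ (N.comap ι) < 2 := by
      have : N.comap ι ≠ ⊤ := fun h => by
        obtain ⟨y, hy⟩ := hne
        exact hy ((hmem y).2 (h ▸ Submodule.mem_top))
      simpa using Submodule.finrank_lt this
    have hpos : Module.finrank ℂ (N.comap ι) ≠ 0 := by
      rw [Ne, Submodule.finrank_eq_zero]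
      intro h
      have h0 : ι ![1, 0] ∉ N := fun h' => by
        have : ![(1 : ℂ), 0] ∈ N.comap ι := h'
        rw [h, Submodule.mem_bot] at this
        simpa using congrFun this 0
      obtain ⟨c, hc⟩ := hcodim _ h0 (ι ![0, 1])
      rw [← map_smul, ← map_sub, ← Submodule.mem_comap, h, Submodule.mem_bot] at hc
      simpa using congrFun hc 1
    omega
  refine ⟨perp (mk'' (N.comap ι) hfin), Submodule.ext fun x => ?_⟩
  rw [mem_range_factor, lineProj_perp_eq_zero_iff, submodule_mk'', hmem]

/-- Every descending chain of shift-stable lattices with one-dimensional steps comes from a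
sequence of lines. -/
theorem exists_eq_lattice {n m : ℕ} {N : ℕ → Submodule ℂ PlaneSeries} (h0 : N 0 = ⊤)
    (hshift : ∀ j, ∀ x ∈ N j, shift x ∈ N j) (hn : ∀ j, LinearMap.range (shift ^ n) ≤ N j)
    (hlt : ∀ j < m, N (j + 1) < N j)
    (hcodim : ∀ j < m, ∀ y ∈ N j, y ∉ N (j + 1) → ∀ x ∈ N j, ∃ c : ℂ, x - c • y ∈ N (j + 1)) :
    ∃ l : Fin m → ComplexProjectiveLine, ∀ j ≤ m, N j = lattice l j := by
  suffices ∃ ls : List ComplexProjectiveLine, ls.length = m ∧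
      ∀ j ≤ m, N j = LinearMap.range (factorProd (ls.take j)) by
    obtain ⟨ls, rfl, h⟩ := this
    refine ⟨ls.get, fun j hj => ?_⟩
    rw [lattice, List.ofFn_get, h j hj]
  induction m with
  | zero =>
    refine ⟨[], rfl, fun j hj => ?_⟩
    obtain rfl : j = 0 := by omega
    simp [h0, Module.End.one_eq_id]
  | succ m ih =>
    obtain ⟨ls, hls, h⟩ := ih (fun j hj => hlt j (by omega)) (fun j hj => hcodim j (by omega))
    have hm := h m le_rfl
    rw [List.take_of_length_le hls.le] at hm
    have hmem (x : PlaneSeries) : factorProd ls x ∈ N m := hm ▸ ⟨x, rfl⟩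
    have hcomm (x : PlaneSeries) : factorProd ls (shift x) = shift (factorProd ls x) :=
      LinearMap.congr_fun (factorProd_mul_shift ls) x
    have hcomm' (x : PlaneSeries) (k : ℕ) :
        factorProd ls ((shift ^ k) x) = (shift ^ k) (factorProd ls x) := by
      induction k with
      | zero => rfl
      | succ k ih => rw [pow_succ', Module.End.mul_apply, hcomm, ih, Module.End.mul_apply]
    -- `N m` is the range of `factorProd ls`, so pulling `N (m + 1)` back along it reduces to a step
    -- of codimension one in the full space.
    obtain ⟨l, hl⟩ := exists_eq_range_factor (n := n) (N := (N (m + 1)).comap (factorProd ls))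
      (fun x hx => by
        rw [Submodule.mem_comap, hcomm]
        exact hshift _ _ hx)
      (by
        rintro _ ⟨x, rfl⟩
        rw [Submodule.mem_comap, hcomm']
        exact hn _ ⟨_, rfl⟩)
      (by
        obtain ⟨y, hy, hy'⟩ := SetLike.exists_of_lt (hlt m (by omega))
        rw [hm] at hy
        obtain ⟨x, rfl⟩ := hy
        exact ⟨x, hy'⟩)
      (fun y hy x => by
        obtain ⟨c, hc⟩ := hcodim m (by omega) _ (hmem y) hy _ (hmem x)
        exact ⟨c, by simpa using hc⟩)
    refine ⟨ls ++ [l], by simp [hls], fun j hj => ?_⟩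
    rcases Nat.lt_or_eq_of_le hj with hj | rfl
    · rw [List.take_append_of_le_length (by omega), h j (by omega)]
    · rw [List.take_of_length_le (by simp [hls]), factorProd_append, factorProd_cons,
        factorProd_nil, mul_one, Module.End.mul_eq_comp, LinearMap.range_comp, ← hl,
        Submodule.map_comap_eq, ← hm, inf_of_le_right (hlt m (by omega)).le]

end Lattice

/-! ### Continuity of products of factors in lifted lines. -/

section Continuity

variable {X : Type*} [TopologicalSpace X]

theorem continuous_shift : Continuous shift := by
  refine continuous_pi fun k => ?_
  cases k with
  | zero => exact continuous_const
  | succ k => exact continuous_apply k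

theorem continuous_factor_mk' {u : X → {v : Fin 2 → ℂ // v ≠ 0}} {y : X → PlaneSeries}
    (hu : Continuous u) (hy : Continuous y) :
    Continuous fun x => factor (mk' ℂ (u x)) (y x) := by
  refine continuous_pi fun k => ?_
  have h1 : Continuous fun x => y x k := (continuous_apply k).comp hy
  have h2 : Continuous fun x => shift (y x) k :=
    (continuous_apply k).comp (continuous_shift.comp hy)
  simp only [factor_apply, lineProj_perp]
  exact (h1.sub (continuous_lineProj_mk' hu h1)).add (continuous_lineProj_mk' hu h2)

theorem continuous_factorProd_map_mk' {us : List (X → {v : Fin 2 → ℂ // v ≠ 0})}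
    (hus : ∀ u ∈ us, Continuous u) {y : X → PlaneSeries} (hy : Continuous y) :
    Continuous fun x => factorProd (us.map fun u => mk' ℂ (u x)) (y x) := by
  induction us with
  | nil => simpa using hy
  | cons u us ih =>
    simp only [List.map_cons, factorProd_cons, Module.End.mul_apply]
    simp only [List.mem_cons, forall_eq_or_imp] at hus
    exact continuous_factor_mk' hus.1 (ih hus.2)

theorem continuous_factorProd_take {m : ℕ} {u : X → Fin m → {v : Fin 2 → ℂ // v ≠ 0}}
    (hu : Continuous u) (j : ℕ) {y : X → PlaneSeries} (hy : Continuous y) :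
    Continuous fun x => factorProd ((List.ofFn fun i => mk' ℂ (u x i)).take j) (y x) := by
  have key (x : X) : (List.ofFn fun i => mk' ℂ (u x i)).take j =
      ((List.ofFn fun i x => u x i).take j).map fun u => mk' ℂ (u x) := by
    rw [List.map_take, List.map_ofFn]
    rfl
  simp only [key]
  refine continuous_factorProd_map_mk' (fun v hv => ?_) hy
  obtain ⟨i, rfl⟩ := List.mem_ofFn.1 (List.mem_of_mem_take hv)
  exact (continuous_apply i).comp hu

end Continuity

/-! ### Passage from lattices to flags in E. -/

section Truncation

variable {E : Type*} [AddCommGroup E] [Module ℂ E] {n : ℕ}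

/-- The truncation of power series, in terms of a Jordan basis of a space with two Jordan blocks
of size `n`. -/
noncomputable def trunc (b : Module.Basis (Fin 2 × Fin n) ℂ E) : PlaneSeries →ₗ[ℂ] E where
  -- The index is reversed because `z` lowers the position in a Jordan block while the shift raises
  -- the degree.
  toFun m := ∑ i : Fin 2, ∑ k : Fin n, m k.rev i • b (i, k)
  map_add' m m' := by simp [add_smul, Finset.sum_add_distrib]
  map_smul' c m := by simp [mul_smul, Finset.smul_sum]

variable (b : Module.Basis (Fin 2 × Fin n) ℂ E)

theorem trunc_apply (m : PlaneSeries) :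
    trunc b m = ∑ i : Fin 2, ∑ k : Fin n, m k.rev i • b (i, k) := rfl

theorem trunc_eq (m : PlaneSeries) :
    trunc b m = b.equivFun.symm fun p => m p.2.rev p.1 := by
  rw [trunc_apply, Module.Basis.equivFun_symm_apply, Fintype.sum_prod_type]

theorem ker_trunc : LinearMap.ker (trunc b) = LinearMap.range (shift ^ n) := by
  ext m
  rw [LinearMap.mem_ker, trunc_eq, LinearEquiv.map_eq_zero_iff, mem_range_shift_pow]
  constructor
  · intro h k hk
    ext i
    simpa using congrFun h (i, Fin.rev ⟨k, hk⟩)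
  · intro h
    ext p
    rw [h _ p.2.rev.2]
    rfl

theorem trunc_surjective : Function.Surjective (trunc b) := by
  intro x
  refine ⟨fun k i => if h : k < n then b.equivFun x (i, Fin.rev ⟨k, h⟩) else 0, ?_⟩
  rw [trunc_eq, LinearEquiv.symm_apply_eq]
  ext p
  rw [dif_pos p.2.rev.2, Fin.eta, Fin.rev_rev]

theorem trunc_shift {z : E →ₗ[ℂ] E}
    (hz : ∀ (i : Fin 2) (k : Fin n), ((k : ℕ) = 0 → z (b (i, k)) = 0) ∧
      ∀ k' : Fin n, (k : ℕ) = (k' : ℕ) + 1 → z (b (i, k)) = b (i, k')) (m : PlaneSeries) :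
    trunc b (shift m) = z (trunc b m) := by
  rw [trunc_apply, trunc_apply, map_sum]
  refine Finset.sum_congr rfl fun i _ => ?_
  cases n with
  | zero => simp
  | succ n =>
    rw [Fin.sum_univ_castSucc, Fin.sum_univ_succ, map_add, map_sum, map_smul,
      (hz i 0).1 rfl, smul_zero, zero_add]
    simp only [Fin.rev_last, Fin.val_zero, shift_apply_zero, Pi.zero_apply, zero_smul, add_zero,
      Fin.rev_castSucc, Fin.rev_succ, Fin.val_succ, Fin.val_castSucc, shift_apply_succ, map_smul]
    refine Finset.sum_congr rfl fun k _ => ?_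
    rw [(hz i k.succ).2 k.castSucc rfl]

theorem continuous_trunc [TopologicalSpace E] [ContinuousAdd E] [ContinuousSMul ℂ E] :
    Continuous (trunc b) := by
  change Continuous fun m : PlaneSeries => ∑ i : Fin 2, ∑ k : Fin n, m k.rev i • b (i, k)
  fun_prop

/-- The last lattice is the kernel of the truncation, and all earlier ones contain it; so no
information is lost in E. -/
theorem comap_map_trunc_lattice {m : ℕ} {l : Fin m → ComplexProjectiveLine}
    (hl : factorProd (List.ofFn l) = shift ^ n) {j : ℕ} (hj : j ≤ m) :
    ((lattice l j).map (trunc b)).comap (trunc b) = lattice l j := by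
  refine Submodule.comap_map_eq_self ?_
  rw [ker_trunc, ← hl]
  refine le_trans (le_of_eq ?_) (lattice_antitone hj)
  rw [lattice, List.take_of_length_le (by simp)]

/-- The complete flag attached to a sequence of lines. -/
noncomputable def flagOfLines (l : Fin (2 * n) → ComplexProjectiveLine)
    (hl : factorProd (List.ofFn l) = shift ^ n) : CompleteFlag (2 * n) E where
  space j := (lattice l (2 * n - j)).map (trunc b)
  strictMono := by
    refine Fin.strictMono_iff_lt_succ.2 fun i => lt_of_le_of_ne ?_ fun h => ?_
    · refine Submodule.map_mono (lattice_antitone ?_)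
      simp only [Fin.val_castSucc, Fin.val_succ]
      omega
    · have h' := congrArg (Submodule.comap (trunc b)) h
      rw [comap_map_trunc_lattice b hl (by omega), comap_map_trunc_lattice b hl (by omega)] at h'
      have h1 := lattice_succ_lt (l := l) i.rev
      have e1 : ((i.rev : Fin (2 * n)) : ℕ) = 2 * n - i.succ := by simp
      have e2 : 2 * n - (i.succ : ℕ) + 1 = 2 * n - i.castSucc := by
        simp only [Fin.val_castSucc, Fin.val_succ]
        omega
      rw [e1, e2] at h1
      exact h1.ne h'
  space_zero := by
    rw [eq_bot_iff, Submodule.map_le_iff_le_comap, Submodule.comap_bot, ker_trunc, ← hl, lattice,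
      List.take_of_length_le (by simp)]
  space_last := by
    rw [Fin.val_last, Nat.sub_self, lattice_zero, Submodule.map_top,
      LinearMap.range_eq_top.2 (trunc_surjective b)]

theorem flagOfLines_space (l : Fin (2 * n) → ComplexProjectiveLine)
    (hl : factorProd (List.ofFn l) = shift ^ n) (j : Fin (2 * n + 1)) :
    (flagOfLines b l hl).space j = (lattice l (2 * n - j)).map (trunc b) := rfl

theorem flagOfLines_injective {l l' : Fin (2 * n) → ComplexProjectiveLine}
    (hl : factorProd (List.ofFn l) = shift ^ n) (hl' : factorProd (List.ofFn l') = shift ^ n)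
    (h : flagOfLines b l hl = flagOfLines b l' hl') : l = l' := by
  refine eq_of_lattice_eq fun j hj => ?_
  have h1 := congrFun (congrArg CompleteFlag.space h) ⟨2 * n - j, by omega⟩
  have h2 := congrArg (Submodule.comap (trunc b)) h1
  rw [flagOfLines_space, flagOfLines_space, comap_map_trunc_lattice b hl (by omega),
    comap_map_trunc_lattice b hl' (by omega)] at h2
  simpa [Nat.sub_sub_self hj] using h2

theorem finrank_eq_two_mul (b : Module.Basis (Fin 2 × Fin n) ℂ E) : Module.finrank ℂ E = 2 * n := by
  rw [Module.finrank_eq_card_basis b]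
  simp

variable {z : E →ₗ[ℂ] E}

theorem flagOfLines_mem_springerVariety
    (hz : ∀ (i : Fin 2) (k : Fin n), ((k : ℕ) = 0 → z (b (i, k)) = 0) ∧
      ∀ k' : Fin n, (k : ℕ) = (k' : ℕ) + 1 → z (b (i, k)) = b (i, k'))
    (l : Fin (2 * n) → ComplexProjectiveLine)
    (hl : factorProd (List.ofFn l) = shift ^ n) : flagOfLines b l hl ∈ springerVariety n z := by
  intro j
  rw [flagOfLines_space]
  rintro _ ⟨_, ⟨x, hx, rfl⟩, rfl⟩
  exact ⟨shift x, shift_mem_lattice hx, trunc_shift b hz x⟩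

/-- The flag equation is quantified over `hl` because only the inclusion of ranges is available
here. That the product equals `shift ^ n` follows later, through membership in S̃. -/
theorem exists_flagOfLines_eq
    (hz : ∀ (i : Fin 2) (k : Fin n), ((k : ℕ) = 0 → z (b (i, k)) = 0) ∧
      ∀ k' : Fin n, (k : ℕ) = (k' : ℕ) + 1 → z (b (i, k)) = b (i, k'))
    {L : CompleteFlag (2 * n) E} (hL : L ∈ springerVariety n z) :
    ∃ l, LinearMap.range (factorProd (List.ofFn l)) ≤ LinearMap.range (shift ^ n) ∧
      ∀ hl, flagOfLines b l hl = L := by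
  have : FiniteDimensional ℂ E := Module.Basis.finiteDimensional_of_finite b
  -- For `j > 2 * n` the truncated subtraction gives the kernel of `trunc b`, so the conditions
  -- required for all `j` still hold.
  let N : ℕ → Submodule ℂ PlaneSeries := fun j =>
    (L.space ⟨2 * n - j, by omega⟩).comap (trunc b)
  have hstep {j : ℕ} (hj : j < 2 * n) :
      L.space ⟨2 * n - (j + 1), by omega⟩ ⋖ L.space ⟨2 * n - j, by omega⟩ := by
    have h := L.space_covBy (finrank_eq_two_mul b) ⟨2 * n - (j + 1), by omega⟩
    rwa [show Fin.succ ⟨2 * n - (j + 1), by omega⟩ = (⟨2 * n - j, by omega⟩ : Fin (2 * n + 1)) from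
      Fin.ext (by simp only [Fin.val_succ]; omega)] at h
  obtain ⟨l, hl⟩ := exists_eq_lattice (n := n) (m := 2 * n) (N := N)
    (by
      have : (⟨2 * n - 0, by omega⟩ : Fin (2 * n + 1)) = Fin.last (2 * n) := rfl
      simp only [N, this, L.space_last, Submodule.comap_top])
    (fun j x hx => by
      simp only [N, Submodule.mem_comap, trunc_shift b hz] at hx ⊢
      exact hL _ ⟨_, hx, rfl⟩)
    (fun j => by
      rw [← ker_trunc b]
      exact LinearMap.ker_le_comap (trunc b))
    (fun j hj => by
      refine lt_of_le_not_ge (Submodule.comap_mono (hstep hj).le) fun h => ?_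
      rw [Submodule.comap_le_comap_iff_of_surjective (trunc_surjective b)] at h
      exact (hstep hj).lt.not_ge h)
    (fun j hj y hy hy' x hx => by
      simp only [N, Submodule.mem_comap] at hy hy' hx
      -- By the covering relation, one vector outside the smaller space spans the larger one
      -- together with it.
      have hsup := ((hstep hj).eq_or_eq
        (c := Submodule.span ℂ {trunc b y} ⊔ L.space ⟨2 * n - (j + 1), by omega⟩) le_sup_right
        (sup_le (by simpa using hy) (hstep hj).le)).resolve_left fun h => hy'
          (h ▸ Submodule.mem_sup_left (Submodule.mem_span_singleton_self _))
      rw [← hsup, Submodule.mem_sup] at hx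
      obtain ⟨s, hs, t, ht, hst⟩ := hx
      obtain ⟨c, rfl⟩ := Submodule.mem_span_singleton.1 hs
      refine ⟨c, ?_⟩
      simp only [N, Submodule.mem_comap, map_sub, map_smul]
      rwa [← hst, add_sub_cancel_left])
  refine ⟨l, ?_, fun h => CompleteFlag.ext (funext fun j => ?_)⟩
  · have h := hl (2 * n) le_rfl
    have h0 : (⟨2 * n - 2 * n, by omega⟩ : Fin (2 * n + 1)) = 0 := Fin.ext (Nat.sub_self _)
    simp only [N, h0, L.space_zero, Submodule.comap_bot, ker_trunc] at h
    rw [h, lattice, List.take_of_length_le (by simp)]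
  · rw [flagOfLines_space, ← hl _ (Nat.sub_le _ _),
      Submodule.map_comap_eq_of_surjective (trunc_surjective b)]
    congr 1
    ext
    simp only
    omega

theorem continuous_flagOfLines [TopologicalSpace E] [ContinuousAdd E] [ContinuousSMul ℂ E] :
    Continuous fun l : {l : Fin (2 * n) → ComplexProjectiveLine //
      factorProd (List.ofFn l) = shift ^ n} => flagOfLines b l.1 l.2 := by
  have : FiniteDimensional ℂ E := Module.Basis.finiteDimensional_of_finite b
  let s : Set (Fin (2 * n) → ComplexProjectiveLine) := {l | factorProd (List.ofFn l) = shift ^ n}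
  let p : (Fin (2 * n) → {v : Fin 2 → ℂ // v ≠ 0}) → Fin (2 * n) → ComplexProjectiveLine :=
    Pi.map fun _ => mk' ℂ
  have hp : IsOpenQuotientMap (s.restrictPreimage p) :=
    (IsOpenQuotientMap.piMap fun _ => isOpenQuotientMap_mk').restrictPreimage s
  refine hp.continuous_comp_iff.1 ?_
  -- The vector `u i.rev` spans its line, so its image under the first `i.rev` factors lies in
  -- lattice `i.rev` but not in the next one. These images form a basis adapted to the flag and
  -- continuous in `u`.
  let v : p ⁻¹' s → Fin (2 * n) → E := fun u i =>
    trunc b (factorProd ((List.ofFn (p u.1)).take i.rev) fun _ => u.1 i.rev)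
  have hv : Continuous v := by
    refine continuous_pi fun i => (continuous_trunc b).comp ?_
    refine continuous_factorProd_take continuous_subtype_val _ (continuous_pi fun _ => ?_)
    exact continuous_subtype_val.comp ((continuous_apply _).comp continuous_subtype_val)
  have hex (u : p ⁻¹' s) := (flagOfLines b (p u.1) u.2).exists_ofBasis_eq (finrank_eq_two_mul b)
    (v u) (fun i => by
      rw [flagOfLines_space]
      refine Submodule.mem_map_of_mem ?_
      rw [show 2 * n - (i.succ : ℕ) = i.rev by simp]
      exact ⟨_, rfl⟩)
    (fun i h => by
      rw [flagOfLines_space, ← Submodule.mem_comap,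
        comap_map_trunc_lattice b u.2 (by omega),
        show 2 * n - (i.castSucc : ℕ) = i.rev + 1 by simp; omega,
        factorProd_take_mem_lattice_succ] at h
      have h' : lineProj (mk ℂ (u.1 i.rev).1 (u.1 i.rev).2) (u.1 i.rev).1 = 0 := h
      rw [lineProj_mk, vectorProj_apply, div_self (star_dotProduct_self_ne_zero (u.1 i.rev).2),
        one_smul] at h'
      exact (u.1 i.rev).2 h')
  choose β hβ hβ' using hex
  let _ : TopologicalSpace (Module.Basis (Fin (2 * n)) ℂ E) :=
    TopologicalSpace.induced (fun (b : Module.Basis (Fin (2 * n)) ℂ E) i => b i) inferInstance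
  have hβc : Continuous β := continuous_induced_rng.2 (by
    convert hv using 1
    ext u i
    exact hβ u i)
  have : (fun l : s => flagOfLines b l.1 l.2) ∘ s.restrictPreimage p =
      CompleteFlag.ofBasis ∘ β := funext fun u => (hβ' u).symm
  exact this ▸ continuous_coinduced_rng.comp hβc

end Truncation

end PlaneSeries

/-! ### The homeomorphism. -/

open PlaneSeries

theorem theorem1 {E : Type*} [AddCommGroup E] [Module ℂ E] [TopologicalSpace E]
    [IsTopologicalAddGroup E] [ContinuousSMul ℂ E] [T2Space E]
    (n : ℕ) (z : E →ₗ[ℂ] E) (hz : HasTwoNilpotentJordanBlocks n z) :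
    Nonempty (springerVariety n z ≃ₜ khovanovSpace n) := by
  obtain ⟨b, hb⟩ := hz
  have : FiniteDimensional ℂ E := Module.Basis.finiteDimensional_of_finite b
  have : CompactSpace (khovanovSpace n) := isCompact_iff_compactSpace.1 (isCompact_khovanovSpace n)
  let f : khovanovSpace n → springerVariety n z := fun l =>
    ⟨flagOfLines b (alternate l.1) (factorProd_alternate_of_mem_khovanovSpace l.2),
      flagOfLines_mem_springerVariety b hb _ _⟩
  have hf : Continuous f := Continuous.subtype_mk ((continuous_flagOfLines b).comp
    ((continuous_alternate.comp continuous_subtype_val).subtype_mk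
      fun l => factorProd_alternate_of_mem_khovanovSpace l.2)) _
  have hbij : Function.Bijective f := by
    constructor
    · intro l l' h
      have h' := flagOfLines_injective b
        (factorProd_alternate_of_mem_khovanovSpace l.2)
        (factorProd_alternate_of_mem_khovanovSpace l'.2) (congrArg Subtype.val h)
      refine Subtype.ext ?_
      rw [← alternate_alternate l.1, h', alternate_alternate]
    · rintro ⟨L, hL⟩
      obtain ⟨l, hl, h⟩ := exists_flagOfLines_eq b hb hL
      rw [← alternate_alternate l] at hl h
      have hmem := mem_khovanovSpace_of_range_le hl
      exact ⟨⟨alternate l, hmem⟩,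
        Subtype.ext (h (factorProd_alternate_of_mem_khovanovSpace hmem))⟩
  -- A continuous bijection from a compact space to a Hausdorff space is a homeomorphism.
  exact ⟨(hf.homeoOfEquivCompactToT2 (f := Equiv.ofBijective f hbij)).symm⟩
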